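/- Let $\mathbf C$ be a field of characteristic zero with zero derivation. Let $\mathbf C\langle\eta\rangle=\mathbf C(\eta)[\nu]$ be a hyperelliptic differential extension of $\mathbf C$: $\eta$ is transcendental over $\mathbf C$, $\nu$ is algebraic of degree at most two over $\mathbf C(\eta)$, and $\partial\eta=\nu$. Let $\Theta$ be a finite set of parameters, and let $\mathbf C(\Theta)\langle\eta\rangle=\mathbf C(\Theta)(\eta)[\nu]$ (with the same minimal polynomial of $\nu$) carry the extended derivation with $\partial\theta=0$ for $\theta\in\Theta$. Every $\alpha\in\mathbf C(\Theta)\langle\eta\rangle$ is written as $\alpha=\frac{p_0}{q_0}+\frac{p_1}{q_1}\nu$ with fractions $p_e/q_e$ in lowest terms over the factorial ring $\mathbf C[\Theta][\eta]$ (and $p_1=0$ if $\nu\in\mathbf C(\eta)$). For $\zeta\in\mathbf C^{\Theta}$ we say that $\alpha$ is regular at $\zeta$ if neither $q_0$ nor $q_1$ becomes the zero polynomial in $\mathbf C[\eta]$ under $\Theta\mapsto\zeta$; then $\alpha(\zeta)\in\mathbf C\langle\eta\rangle$ is defined by substitution. Let $n\ge 2$, let $L_n=\partial^n+u_2\partial^{n-2}+\dots+u_n$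 be the formal operator over the differential polynomial ring $\mathbf C\{u_2,\dots,u_n\}$, let $P_m=(L_n^{m/n})_+$ be the differential operator part of the $m$-th power of the monic $n$-th root of $L_n$ in the ring of formal pseudo-differential operators, and let $H_{k,m}$ be the coefficient of $\partial^k$ in $[P_m,L_n]$, $0\le k\le n-2$. Put $J_{n,m}=\{1\le j\le m: n\nmid j\}$. For $L=\partial^n+v_2\partial^{n-2}+\dots+v_n$ with coefficients in a differential $\mathbf C$-algebra let $\sigma_{k,j}(L)$ be obtained from $H_{k,j}$ by $u_\ell\mapsto v_\ell$, and let $$V_m(L)=\Big\{c\in\mathbf C^{J_{n,m}} : \sum_{j\in J_{n,m}}c_j\,\sigma_{k,j}(L)=0,\ k=0,\dots,n-2\Big\}.$$ Let $\mathbb L=\partial^n+f_2\partial^{n-2}+\dots+f_n$ with $f_2,\dots,f_n\in\mathbf C(\Theta)\langle\eta\rangle$, and let $D\subseteq\mathbf C^{\Theta}$ be the set of $\zeta$ at which all $f_i$ are regular, so that $\mathbb L(\zeta)=\partial^n+f_2(\zeta)\partial^{n-2}+\dots+f_n(\zeta)$ is defined. The $m$-th level variety is $\mathcal X_m=\{\zeta\in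 D : V_m(\mathbb L(\zeta))\ne\{0\}\}$. The matrix $S_\Theta(n,m)$, with columns indexed by $J_{n,m}$, is obtained as follows: for every $k\in\{0,\dots,n-2\}$ and $e\in\{0,1\}$ write the $\nu^e$-coordinates of the $\sigma_{k,j}(\mathbb L)$, $j\in J_{n,m}$, in lowest terms as $p_j/q_j$ over $\mathbf C[\Theta][\eta]$, multiply them by the least common multiple of the $q_j$ in $\mathbf C[\Theta][\eta]$, and take as rows the nonzero vectors of coefficients of $\eta^h$, $h\ge 0$, of the resulting polynomials. The $m$-th level ideal $I_m\subseteq\mathbf C[\Theta]$ is generated by the numerators of all minors of size $|J_{n,m}|$ of $S_\Theta(n,m)$ (it is $0$ if there are fewer than $|J_{n,m}|$ rows). Then, for every $m\ge 0$, $$\mathcal X_m=\{\zeta\in D : g(\zeta)=0\ \text{ for all } g\in I_m\};$$ in particular $\mathcal X_m=V(I_m)$ if $D=\mathbf C^{\Theta}$. Moreover $\mathcal X_{m-1}\subseteq\mathcal X_m$ for every $m\ge 1$. -/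

import Mathlib

open Polynomial

noncomputable section

/-! ### Pseudo-differential operators -/

/-- A formal pseudo-differential operator `∑_{l ≤ N} a_l ∂^l` with coefficients in `R`. -/
@[ext]
structure PDO (R : Type*) [CommRing R] where
  coeff : ℤ → R
  bdd : ∃ N : ℤ, ∀ l, N < l → coeff l = 0

namespace PDO

section Ops

variable {C : Type*} [Field C] {R : Type*} [CommRing R] [Algebra C R]

/-- The coefficient of `∂^l` in `A * B`, from the rule
`a ∂^s * b ∂^t = ∑_k (s choose k) a δ^k(b) ∂^(s+t-k)`. -/
def mulCoeff (δ : Derivation C R R) (A B : PDO R) (l : ℤ) : R :=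
  ∑ᶠ p : ℤ × ℕ, ((Ring.choose p.1 p.2 : ℤ) : R) *
    (A.coeff p.1 * (δ^[p.2]) (B.coeff (l - p.1 + p.2)))

lemma iter_zero (δ : Derivation C R R) (k : ℕ) : (δ^[k]) 0 = 0 := by
  induction k with
  | zero => rfl
  | succ k ih => rw [Function.iterate_succ_apply', ih, map_zero]

lemma term_ne {δ : Derivation C R R} {A B : PDO R} {M N l : ℤ}
    (hA : ∀ s, M < s → A.coeff s = 0) (hB : ∀ t, N < t → B.coeff t = 0) {p : ℤ × ℕ}
    (hp : ((Ring.choose p.1 p.2 : ℤ) : R) *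
      (A.coeff p.1 * (δ^[p.2]) (B.coeff (l - p.1 + p.2))) ≠ 0) :
    p.1 ≤ M ∧ l - p.1 + p.2 ≤ N := by
  constructor
  · by_contra h
    exact hp (by rw [hA _ (not_le.mp h)]; simp)
  · by_contra h
    exact hp (by rw [hB _ (not_le.mp h), iter_zero]; simp)

lemma mul_finite (δ : Derivation C R R) (A B : PDO R) (l : ℤ) :
    (Function.support fun p : ℤ × ℕ => ((Ring.choose p.1 p.2 : ℤ) : R) *
      (A.coeff p.1 * (δ^[p.2]) (B.coeff (l - p.1 + p.2)))).Finite := by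
  obtain ⟨M, hM⟩ := A.bdd
  obtain ⟨N, hN⟩ := B.bdd
  refine ((Set.finite_Icc (l - N) M).prod (Set.finite_Iic (M + N - l).toNat)).subset ?_
  intro p hp
  have := term_ne hM hN hp
  simp only [Set.mem_prod, Set.mem_Icc, Set.mem_Iic]
  omega

/-- The product of pseudo-differential operators. -/
def mul (δ : Derivation C R R) (A B : PDO R) : PDO R where
  coeff := mulCoeff δ A B
  bdd := by
    obtain ⟨M, hM⟩ := A.bdd
    obtain ⟨N, hN⟩ := B.bdd
    refine ⟨M + N, fun l hl => ?_⟩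
    refine finsum_eq_zero_of_forall_eq_zero fun p => ?_
    by_contra hp
    have := term_ne hM hN hp
    omega

/-- The operator `1`. -/
def one (R : Type*) [CommRing R] : PDO R where
  coeff l := if l = 0 then 1 else 0
  bdd := ⟨0, fun l hl => if_neg (by omega)⟩

/-- The operator `∂`. -/
def del (R : Type*) [CommRing R] : PDO R where
  coeff l := if l = 1 then 1 else 0
  bdd := ⟨1, fun l hl => if_neg (by omega)⟩

/-- The powers `A^m`. -/
def pow (δ : Derivation C R R) (A : PDO R) : ℕ → PDO R
  | 0 => one R
  | m + 1 => mul δ (pow δ A m) A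

/-- The positive part `A_+`. -/
def pos (A : PDO R) : PDO R where
  coeff l := if 0 ≤ l then A.coeff l else 0
  bdd := by
    obtain ⟨M, hM⟩ := A.bdd
    exact ⟨M, fun l hl => by simp [hM l hl]⟩

/-- The operator `∂^n + a_2 ∂^(n-2) + ⋯ + a_n` in normal form; `a i` stands for `a_(i+2)`. -/
def normalForm (n : ℕ) (a : Fin (n - 1) → R) : PDO R where
  coeff l := (if l = n then 1 else 0) +
    ∑ i : Fin (n - 1), if l + ((i : ℕ) + 2 : ℤ) = n then a i else 0
  bdd := by
    refine ⟨n, fun l hl => ?_⟩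
    rw [if_neg (by omega), zero_add]
    exact Finset.sum_eq_zero fun i _ => if_neg (by omega)

/-- Successive approximations of the monic `n`-th root of `L`: the step from `i` to `i + 1`
fills in the coefficient of `∂^(-i)`. -/
def rootSeq (δ : Derivation C R R) (n : ℕ) (L : PDO R) : ℕ → PDO R
  | 0 => del R
  | i + 1 =>
    { coeff := fun l => if l = -(i : ℤ) then
        (n : C)⁻¹ • (L.coeff (n - 1 - i) - (pow δ (rootSeq δ n L i) n).coeff (n - 1 - i))
        else (rootSeq δ n L i).coeff l
      bdd := by
        obtain ⟨M, hM⟩ := (rootSeq δ n L i).bdd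
        refine ⟨max M 0, fun l hl => ?_⟩
        rw [if_neg (by omega), hM l (by omega)] }

lemma rootSeq_coeff_succ (δ : Derivation C R R) (n : ℕ) (L : PDO R) (i : ℕ) (l : ℤ) :
    (rootSeq δ n L (i + 1)).coeff l = if l = -(i : ℤ) then
        (n : C)⁻¹ • (L.coeff (n - 1 - i) - (pow δ (rootSeq δ n L i) n).coeff (n - 1 - i))
        else (rootSeq δ n L i).coeff l := rfl

lemma rootSeq_top (δ : Derivation C R R) (n : ℕ) (L : PDO R) (i : ℕ) :
    ∀ l, 0 < l → (rootSeq δ n L i).coeff l = if l = 1 then 1 else 0 := by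
  induction i with
  | zero => intro l _; rfl
  | succ i ih => intro l hl; rw [rootSeq_coeff_succ, if_neg (by omega), ih l hl]

lemma rootSeq_low (δ : Derivation C R R) (n : ℕ) (L : PDO R) (i : ℕ) :
    ∀ l, l ≤ -(i : ℤ) → (rootSeq δ n L i).coeff l = 0 := by
  induction i with
  | zero => intro l hl; exact if_neg (by push_cast at hl; omega)
  | succ i ih =>
    intro l hl; rw [rootSeq_coeff_succ, if_neg (by omega), ih l (by omega)]

lemma rootSeq_stable (δ : Derivation C R R) (n : ℕ) (L : PDO R) (i j : ℕ) (hij : i ≤ j) :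
    ∀ l, -(i : ℤ) < l → (rootSeq δ n L j).coeff l = (rootSeq δ n L i).coeff l := by
  induction j, hij using Nat.le_induction with
  | base => intros; rfl
  | succ j hj ih => intro l hl; rw [rootSeq_coeff_succ, if_neg (by omega), ih l hl]

/-- The monic `n`-th root `L^(1/n)` of a monic operator `L` of order `n ≥ 1`, in characteristic
zero (see `pow_root` and `root_unique`). -/
def root (δ : Derivation C R R) (n : ℕ) (L : PDO R) : PDO R where
  coeff l := (rootSeq δ n L ((-l).toNat + 1)).coeff l
  bdd := ⟨1, fun l hl => by rw [rootSeq_top _ _ _ _ _ (by omega), if_neg (by omega)]⟩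

/-- `A` has order `m` and leading coefficient `1`. -/
def IsMonic (A : PDO R) (m : ℤ) : Prop := A.coeff m = 1 ∧ ∀ l, m < l → A.coeff l = 0

lemma pow_monic (δ : Derivation C R R) {Q : PDO R} (hQ : Q.IsMonic 1) (m : ℕ) :
    (pow δ Q m).IsMonic m := by
  induction m with
  | zero =>
    simp only [pow]
    exact ⟨by simp [one], fun l hl => if_neg (by push_cast at hl; omega)⟩
  | succ m ih =>
    constructor
    · change mulCoeff δ _ _ _ = 1
      unfold mulCoeff
      rw [finsum_eq_single _ ((m : ℤ), 0)]
      · have : ((m + 1 : ℕ) : ℤ) - (m : ℤ) + ((0 : ℕ) : ℤ) = 1 := by push_cast; ring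
        simp only [this, ih.1, hQ.1]
        simp
      · intro p hp
        by_contra h
        have := term_ne ih.2 hQ.2 h
        apply hp
        ext <;> (push_cast at this ⊢; omega)
    · intro l hl
      refine finsum_eq_zero_of_forall_eq_zero fun p => ?_
      by_contra h
      have := term_ne ih.2 hQ.2 h
      push_cast at hl
      omega

lemma pow_agree (δ : Derivation C R R) {Q Q' : PDO R} (hQ : Q.IsMonic 1) (hQ' : Q'.IsMonic 1)
    (i : ℕ) (h : ∀ l, -(i : ℤ) < l → Q'.coeff l = Q.coeff l) (m : ℕ) :
    (∀ l, (m : ℤ) - 1 - i < l → (pow δ Q' m).coeff l = (pow δ Q m).coeff l) ∧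
    (pow δ Q' m).coeff (m - 1 - i) - (pow δ Q m).coeff (m - 1 - i) =
      m * (Q'.coeff (-i) - Q.coeff (-i)) := by
  induction m with
  | zero => exact ⟨fun _ _ => rfl, by simp [pow]⟩
  | succ m ih =>
    obtain ⟨ih1, ih2⟩ := ih
    have hA := pow_monic δ hQ m
    have hA' := pow_monic δ hQ' m
    have key : ∀ (l : ℤ) (p : ℤ × ℕ), (m : ℤ) - i ≤ l →
        ¬ (l = m - i ∧ (p = ((m : ℤ) - 1 - i, 0) ∨ p = ((m : ℤ), 0))) →
        ((Ring.choose p.1 p.2 : ℤ) : R) *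
          ((pow δ Q' m).coeff p.1 * (δ^[p.2]) (Q'.coeff (l - p.1 + p.2))) =
        ((Ring.choose p.1 p.2 : ℤ) : R) *
          ((pow δ Q m).coeff p.1 * (δ^[p.2]) (Q.coeff (l - p.1 + p.2))) := by
      rintro l ⟨s, k⟩ hl hne
      dsimp only at *
      by_cases hs : (m : ℤ) < s
      · rw [hA.2 _ hs, hA'.2 _ hs]; simp
      by_cases ht : 1 < l - s + k
      · rw [hQ.2 _ ht, hQ'.2 _ ht, iter_zero]; simp
      have h1 : (m : ℤ) - 1 - i < s := by
        by_contra hc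
        apply hne
        have hk : k = 0 := by omega
        subst hk
        refine ⟨by push_cast at ht; omega, Or.inl ?_⟩
        ext
        · push_cast at ht; simp only; omega
        · rfl
      have h2 : -(i : ℤ) < l - s + k := by
        by_contra hc
        apply hne
        have hk : k = 0 := by omega
        subst hk
        refine ⟨by push_cast at hc; omega, Or.inr ?_⟩
        ext
        · push_cast at hc; simp only; omega
        · rfl
      rw [ih1 _ h1, h _ h2]
    constructor
    · intro l hl
      exact finsum_congr fun p => key l p (by push_cast at hl; omega)
        (by rintro ⟨h, -⟩; push_cast at hl; omega)
    · have e0 : ((m + 1 : ℕ) : ℤ) - 1 - i = m - i := by push_cast; ring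
      rw [e0]
      change mulCoeff δ _ _ _ - mulCoeff δ _ _ _ = _
      unfold mulCoeff
      rw [← finsum_sub_distrib (mul_finite δ _ _ _) (mul_finite δ _ _ _)]
      rw [finsum_eq_sum_of_support_subset
        (s := ({((m : ℤ) - 1 - i, 0), ((m : ℤ), 0)} : Finset (ℤ × ℕ)))]
      · rw [Finset.sum_pair (by intro h; rw [Prod.ext_iff] at h; simp only at h; omega)]
        have e1 : (m : ℤ) - i - (m - 1 - i) + ((0 : ℕ) : ℤ) = 1 := by push_cast; ring
        have e2 : (m : ℤ) - i - m + ((0 : ℕ) : ℤ) = -i := by push_cast; ring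
        simp only [e1, e2, hQ.1, hQ'.1, hA.1, hA'.1]
        simp only [Ring.choose_zero_right, Int.cast_one, one_mul, Function.iterate_zero, id_eq,
          mul_one]
        rw [ih2]
        push_cast
        ring
      · intro p hp
        by_contra hc
        apply hp
        refine sub_eq_zero.mpr (key _ p le_rfl ?_)
        rintro ⟨-, h⟩
        exact hc (by simpa using h)

lemma root_coeff (δ : Derivation C R R) (n : ℕ) (L : PDO R) (l : ℤ) :
    (root δ n L).coeff l = (rootSeq δ n L ((-l).toNat + 1)).coeff l := rfl

lemma root_monic (δ : Derivation C R R) (n : ℕ) (L : PDO R) : (root δ n L).IsMonic 1 :=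
  ⟨by rw [root_coeff, rootSeq_top _ _ _ _ _ one_pos, if_pos rfl],
   fun l hl => by
    rw [root_coeff, rootSeq_top _ _ _ _ _ (by omega), if_neg (by omega)]⟩

/-- `root` is an `n`-th root. -/
theorem pow_root [CharZero C] (δ : Derivation C R R) {n : ℕ} (hn : 0 < n) {L : PDO R}
    (hL : L.IsMonic n) : pow δ (root δ n L) n = L := by
  have hs : ∀ i, (rootSeq δ n L i).IsMonic 1 := fun i =>
    ⟨by rw [rootSeq_top _ _ _ _ _ one_pos, if_pos rfl],
     fun l hl => by rw [rootSeq_top _ _ _ _ _ (by omega), if_neg (by omega)]⟩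
  have hr := root_monic δ n L
  have hp := pow_monic δ hr n
  ext l
  rcases lt_trichotomy l (n : ℤ) with hl | hl | hl
  · obtain ⟨i, rfl⟩ : ∃ i : ℕ, l = n - 1 - i := ⟨((n : ℤ) - 1 - l).toNat, by omega⟩
    have h1 : ∀ l, -((i + 1 : ℕ) : ℤ) < l →
        (root δ n L).coeff l = (rootSeq δ n L (i + 1)).coeff l := by
      intro l hl
      change (rootSeq δ n L ((-l).toNat + 1)).coeff l = _
      rcases le_total ((-l).toNat + 1) (i + 1) with h | h
      · exact (rootSeq_stable δ n L _ _ h l (by omega)).symm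
      · exact rootSeq_stable δ n L _ _ h l hl
    have h2 := (pow_agree δ (hs (i + 1)) hr (i + 1) h1 n).1 (n - 1 - i) (by push_cast; omega)
    have h3 := (pow_agree δ (hs i) (hs (i + 1)) i
      (fun l hl => rootSeq_stable δ n L i (i + 1) (by omega) l hl) n).2
    rw [h2, eq_add_of_sub_eq h3, rootSeq_coeff_succ, if_pos rfl, rootSeq_low _ _ _ _ _ le_rfl,
      sub_zero]
    have hn' : (n : C) ≠ 0 := by exact_mod_cast hn.ne'
    rw [show ((n : ℕ) : R) = algebraMap C R (n : C) by simp, ← Algebra.smul_def, smul_smul,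
      mul_inv_cancel₀ hn', one_smul]
    ring
  · subst hl; rw [hp.1, hL.1]
  · rw [hp.2 l hl, hL.2 l hl]

/-- The monic `n`-th root is unique. -/
theorem root_unique [CharZero C] (δ : Derivation C R R) {n : ℕ} (hn : 0 < n) {Q Q' : PDO R}
    (hQ : Q.IsMonic 1) (hQ' : Q'.IsMonic 1) (h : pow δ Q n = pow δ Q' n) : Q = Q' := by
  have main : ∀ i : ℕ, ∀ l, -(i : ℤ) < l → Q'.coeff l = Q.coeff l := by
    intro i
    induction i with
    | zero =>
      intro l hl
      rcases eq_or_ne l 1 with rfl | h1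
      · rw [hQ.1, hQ'.1]
      · have : 1 < l := by push_cast at hl; omega
        rw [hQ.2 l this, hQ'.2 l this]
    | succ i ih =>
      intro l hl
      rcases eq_or_ne l (-(i : ℤ)) with rfl | h1
      · have h3 := (pow_agree δ hQ hQ' i ih n).2
        rw [h, sub_self] at h3
        have hn' : (n : C) ≠ 0 := by exact_mod_cast hn.ne'
        have h4 : (n : C) • (Q'.coeff (-i) - Q.coeff (-i)) = 0 := by
          rw [Algebra.smul_def, map_natCast, ← h3]
        rw [smul_eq_zero_iff_right hn'] at h4
        exact sub_eq_zero.mp h4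
      · exact ih l (by push_cast at hl; omega)
  ext l
  exact (main ((-l).toNat + 1) l (by push_cast; omega)).symm

end Ops

end PDO

/-! ### Gelfand–Dickey systems -/

section GD

/-- The differential polynomials `C{u_2, …, u_n}`: the variable `(i, k)` is `u_(i+2)^(k)`. -/
abbrev DiffPoly (C : Type*) [Field C] (n : ℕ) := MvPolynomial (Fin (n - 1) × ℕ) C

/-- The derivation of `C{u_2, …, u_n}`, with `∂ (u_ℓ^(k)) = u_ℓ^(k+1)`. -/
def diffPolyDeriv (C : Type*) [Field C] (n : ℕ) :
    Derivation C (DiffPoly C n) (DiffPoly C n) :=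
  MvPolynomial.mkDerivation C fun p => MvPolynomial.X (p.1, p.2 + 1)

/-- The formal operator `L_n = ∂^n + u_2 ∂^(n-2) + ⋯ + u_n`. -/
def formalL (C : Type*) [Field C] (n : ℕ) : PDO (DiffPoly C n) :=
  PDO.normalForm n fun i => MvPolynomial.X (i, 0)

/-- The operator `P_m = (L_n^(m/n))_+`. -/
def formalP (C : Type*) [Field C] (n m : ℕ) : PDO (DiffPoly C n) :=
  (PDO.pow (diffPolyDeriv C n) (PDO.root (diffPolyDeriv C n) n (formalL C n)) m).pos

/-- The differential polynomial `H_{k,m}`, the coefficient of `∂^k` in `[P_m, L_n]`. -/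
def gdH (C : Type*) [Field C] (n k m : ℕ) : DiffPoly C n :=
  (PDO.mul (diffPolyDeriv C n) (formalP C n m) (formalL C n)).coeff k -
    (PDO.mul (diffPolyDeriv C n) (formalL C n) (formalP C n m)).coeff k

/-- The index set `J_{n,m} = {1, …, m} ∖ nℤ`. -/
def gdIndex (n m : ℕ) : Finset ℕ := (Finset.Icc 1 m).filter fun j => ¬ n ∣ j

variable {C : Type*} [Field C] {R : Type*} [CommRing R] [Algebra C R] {n : ℕ}

/-- The specialization `u_ℓ ↦ v_ℓ` of differential polynomials, `v i` standing for `v_(i+2)`. -/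
def specDiffPoly (δ : Derivation C R R) (v : Fin (n - 1) → R) : DiffPoly C n →ₐ[C] R :=
  MvPolynomial.aeval fun p => (δ^[p.2]) (v p.1)

/-- The coefficient `σ_{k,j}` of the Gelfand–Dickey systems of
`L = ∂^n + v_2 ∂^(n-2) + ⋯ + v_n`. -/
def gdSigma (δ : Derivation C R R) (v : Fin (n - 1) → R) (k : Fin (n - 1)) (j : ℕ) : R :=
  specDiffPoly δ v (gdH C n k j)

/-- The space `V_m(L)` of constant solutions of the homogeneous system
`∑_{j ∈ J_{n,m}} c_j σ_{k,j} = 0`, `k = 0, …, n - 2`. -/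
def gdV (δ : Derivation C R R) (v : Fin (n - 1) → R) (m : ℕ) :
    Submodule C (gdIndex n m → C) where
  carrier := {ξ | ∀ k : Fin (n - 1), ∑ j, ξ j • gdSigma δ v k j = 0}
  zero_mem' k := by simp
  add_mem' {a b} ha hb k := by
    simp only [Set.mem_ofPred_eq, Pi.add_apply, add_smul, Finset.sum_add_distrib] at *
    rw [ha k, hb k, add_zero]
  smul_mem' c a ha k := by
    simp only [Set.mem_ofPred_eq, Pi.smul_apply, smul_eq_mul, mul_smul, ← Finset.smul_sum] at *
    rw [ha k, smul_zero]

end GD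

/-! ### Hyperelliptic extensions -/

section Hyperelliptic

/-- The derivation `d/dη` of `Frac(A[η])`: the unique `A`-linear one that extends the derivative
of polynomials. -/
def etaDeriv (A : Type*) [CommRing A] [IsDomain A] :
    Derivation A (FractionRing A[X]) (FractionRing A[X]) :=
  haveI : Algebra.FormallyEtale A[X] (FractionRing A[X]) :=
    Algebra.FormallyEtale.of_isLocalization (nonZeroDivisors A[X])
  (((Polynomial.mkDerivation A (1 : FractionRing A[X])).liftKaehlerDifferential.liftBaseChange
      (FractionRing A[X])).comp
    (KaehlerDifferential.tensorKaehlerEquivOfFormallyEtale A A[X]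
      (FractionRing A[X])).symm.toLinearMap).compDer
    (KaehlerDifferential.D A (FractionRing A[X]))

lemma etaDeriv_algebraMap (A : Type*) [CommRing A] [IsDomain A] (p : A[X]) :
    etaDeriv A (algebraMap A[X] (FractionRing A[X]) p) =
      algebraMap A[X] (FractionRing A[X]) (derivative p) := by
  have : Algebra.FormallyEtale A[X] (FractionRing A[X]) :=
    Algebra.FormallyEtale.of_isLocalization (nonZeroDivisors A[X])
  change (LinearMap.liftBaseChange (FractionRing A[X])
    (Polynomial.mkDerivation A (1 : FractionRing A[X])).liftKaehlerDifferential)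
    ((KaehlerDifferential.tensorKaehlerEquivOfFormallyEtale A A[X]
      (FractionRing A[X])).symm (KaehlerDifferential.D A (FractionRing A[X]) _)) = _
  rw [KaehlerDifferential.tensorKaehlerEquivOfFormallyEtale_symm_D_algebraMap]
  simp [Polynomial.mkDerivation_apply, Algebra.smul_def]

section Quotient

variable {A : Type*} [CommRing A] [IsDomain A]

/-- The derivation of `Frac(A[η])[Y]` with `η ↦ Y` and `Y ↦ w`. -/
def liftDeriv (w : (FractionRing A[X])[X]) :
    Derivation A (FractionRing A[X])[X] (FractionRing A[X])[X] :=
  (X : (FractionRing A[X])[X]) •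
      (PolynomialModule.equivPolynomialSelf.compDer (etaDeriv A).mapCoeffs) +
    w • (Polynomial.derivative' (R := FractionRing A[X])).restrictScalars A

/-- The polynomial `-s Y P_η(Y)`, where `P_η` is obtained from `P` by applying `d/dη` to the
coefficients. -/
def nuDeriv (P s : (FractionRing A[X])[X]) : (FractionRing A[X])[X] :=
  -(s * (X * PolynomialModule.equivPolynomialSelf ((etaDeriv A).mapCoeffs P)))

lemma liftDeriv_dvd (P s : (FractionRing A[X])[X]) (hs : P ∣ derivative P * s - 1)
    (x : (FractionRing A[X])[X])
    (hx : (AdjoinRoot.mkₐ P).restrictScalars A x = 0) :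
    (AdjoinRoot.mkₐ P).restrictScalars A (liftDeriv (nuDeriv P s) x) = 0 := by
  have hx' : P ∣ x := AdjoinRoot.mk_eq_zero.mp hx
  obtain ⟨g, rfl⟩ := hx'
  obtain ⟨q, hq⟩ := hs
  refine AdjoinRoot.mk_eq_zero.mpr ?_
  rw [Derivation.leibniz]
  refine dvd_add (Dvd.intro _ rfl) (Dvd.dvd.mul_left ?_ _)
  refine ⟨-q * X * PolynomialModule.equivPolynomialSelf ((etaDeriv A).mapCoeffs P), ?_⟩
  have : liftDeriv (nuDeriv P s) P =
      X * PolynomialModule.equivPolynomialSelf ((etaDeriv A).mapCoeffs P) -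
        s * (X * PolynomialModule.equivPolynomialSelf ((etaDeriv A).mapCoeffs P)) *
          derivative P := by
    simp only [liftDeriv, nuDeriv, Derivation.add_apply, Derivation.smul_apply, smul_eq_mul]
    change X * PolynomialModule.equivPolynomialSelf ((etaDeriv A).mapCoeffs P) +
      -(s * (X * PolynomialModule.equivPolynomialSelf ((etaDeriv A).mapCoeffs P))) *
        derivative P = _
    ring
  rw [this]
  linear_combination (-X * PolynomialModule.equivPolynomialSelf
    ((etaDeriv A).mapCoeffs P)) * hq

/-- Let `P` be a polynomial over `Frac(A[η])` and `s` an inverse of `P'` modulo `P`. This is the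
derivation `∂` of `Frac(A[η])[ν] = Frac(A[η])[Y]/(P)` with `∂ a = 0` for `a ∈ A` and `∂ η = ν`;
then necessarily `∂ ν = -s(ν) ν P_η(ν)`. -/
def hypDeriv (P s : (FractionRing A[X])[X]) (hs : P ∣ derivative P * s - 1) :
    Derivation A (AdjoinRoot P) (AdjoinRoot P) :=
  Derivation.liftOfSurjective (f := (AdjoinRoot.mkₐ P).restrictScalars A)
    (d := liftDeriv (nuDeriv P s)) AdjoinRoot.mk_surjective (liftDeriv_dvd P s hs)

lemma hypDeriv_mk (P s : (FractionRing A[X])[X]) (hs : P ∣ derivative P * s - 1)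
    (f : (FractionRing A[X])[X]) :
    hypDeriv P s hs (AdjoinRoot.mk P f) = AdjoinRoot.mk P (liftDeriv (nuDeriv P s) f) :=
  Derivation.liftOfSurjective_apply (f := (AdjoinRoot.mkₐ P).restrictScalars A)
    AdjoinRoot.mk_surjective (liftDeriv_dvd P s hs) f

lemma hypDeriv_eta (P s : (FractionRing A[X])[X]) (hs : P ∣ derivative P * s - 1) :
    hypDeriv P s hs (AdjoinRoot.of P (algebraMap A[X] _ X)) = AdjoinRoot.root P := by
  change hypDeriv P s hs (AdjoinRoot.mk P (Polynomial.C _)) = _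
  rw [hypDeriv_mk]
  simp only [liftDeriv, Derivation.add_apply, Derivation.smul_apply, map_add]
  simp [etaDeriv_algebraMap]

end Quotient

/-- The data of a hyperelliptic extension `C⟨η⟩ = C(η)[ν]`, `ν = ∂ η`: the minimal polynomial of
`ν` over `C(η)`, which is monic and irreducible of degree one or two. -/
structure Hyperelliptic (C : Type*) [Field C] where
  poly : (FractionRing C[X])[X]
  monic : poly.Monic
  irreducible : Irreducible poly
  natDegree_le : poly.natDegree ≤ 2

namespace Hyperelliptic

variable {C : Type*} [Field C] (H : Hyperelliptic C) (Θ : Type*)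

/-- The field `C⟨η⟩ = C(η)[ν]`. -/
abbrev Ext : Type _ := AdjoinRoot H.poly

/-- The inclusion `C(η) → C(Θ)(η)`; the field `C(Θ)(η)` is the fraction field of `C[Θ][η]`. -/
def incl (C : Type*) [Field C] (Θ : Type*) :
    FractionRing C[X] →+* FractionRing (MvPolynomial Θ C)[X] :=
  IsFractionRing.map (j := Polynomial.mapRingHom (MvPolynomial.C (σ := Θ) (R := C)))
    (Polynomial.map_injective _ (MvPolynomial.C_injective Θ C))

/-- The minimal polynomial of `ν` over `C(Θ)(η)`; it stays irreducible, because `C(Θ)(η)` is a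
purely transcendental extension of `C(η)`. -/
abbrev paramPoly : (FractionRing (MvPolynomial Θ C)[X])[X] := H.poly.map (incl C Θ)

/-- The field `C(Θ)⟨η⟩ = C(Θ)(η)[ν]`. -/
abbrev ParamExt : Type _ := AdjoinRoot (H.paramPoly Θ)

section Deriv

variable [CharZero C]

lemma exists_inverse : ∃ s, H.poly ∣ derivative H.poly * s - 1 := by
  obtain ⟨a, b, hab⟩ : H.poly.Separable := by
    have : CharZero (FractionRing C[X]) :=
      charZero_of_injective_algebraMap (algebraMap C (FractionRing C[X])).injective
    exact H.irreducible.separable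
  exact ⟨b, -a, by linear_combination hab⟩

/-- An inverse of the derivative of the minimal polynomial of `ν`, modulo that polynomial. -/
def inverse : (FractionRing C[X])[X] := H.exists_inverse.choose

lemma inverse_spec : H.poly ∣ derivative H.poly * H.inverse - 1 := H.exists_inverse.choose_spec

/-- The derivation of `C⟨η⟩`, with `∂ η = ν` and `∂ c = 0` for `c ∈ C`. -/
def deriv : Derivation C H.Ext H.Ext := hypDeriv H.poly H.inverse H.inverse_spec

/-- The derivation of `C(Θ)⟨η⟩`, with `∂ η = ν`, `∂ c = 0` for `c ∈ C` and `∂ θ = 0` for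
`θ ∈ Θ`. -/
def paramDeriv : Derivation C (H.ParamExt Θ) (H.ParamExt Θ) :=
  (hypDeriv (H.paramPoly Θ) (H.inverse.map (incl C Θ)) (by
    have := Polynomial.map_dvd (incl C Θ) H.inverse_spec
    simpa [Polynomial.derivative_map] using this)).restrictScalars C

end Deriv

variable {Θ}

/-- The coordinates of `α = α_0 + α_1 ν ∈ C(Θ)⟨η⟩` (with `α_1 = 0` if `ν ∈ C(η)`). -/
def coord (α : H.ParamExt Θ) (e : Fin 2) : FractionRing (MvPolynomial Θ C)[X] :=
  (AdjoinRoot.modByMonicHom (H.monic.map (incl C Θ)) α).coeff e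

/-- The numerator in `C[Θ][η]`, in lowest terms, of the coordinate `α_e`. -/
def numer (α : H.ParamExt Θ) (e : Fin 2) : (MvPolynomial Θ C)[X] :=
  IsFractionRing.num (MvPolynomial Θ C)[X] (H.coord α e)

/-- The denominator in `C[Θ][η]`, in lowest terms, of the coordinate `α_e`. -/
def denom (α : H.ParamExt Θ) (e : Fin 2) : (MvPolynomial Θ C)[X] :=
  (IsFractionRing.den (MvPolynomial Θ C)[X] (H.coord α e) : (MvPolynomial Θ C)[X])

/-- The substitution `Θ ↦ ζ` in `C[Θ][η]`. -/
def subst (ζ : Θ → C) : (MvPolynomial Θ C)[X] →+* C[X] :=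
  Polynomial.mapRingHom (MvPolynomial.eval ζ)

/-- The parameters of `α ∈ C(Θ)⟨η⟩` can be replaced by `ζ`: the denominators of `α` do not become
the zero polynomial in `η`. -/
def RegularAt (ζ : Θ → C) (α : H.ParamExt Θ) : Prop := ∀ e, subst ζ (H.denom α e) ≠ 0

/-- The element `α(ζ)` of `C⟨η⟩`, for `α ∈ C(Θ)⟨η⟩` that is regular at `ζ`. -/
def specialize (ζ : Θ → C) (α : H.ParamExt Θ) : H.Ext :=
  ∑ e : Fin 2, AdjoinRoot.of H.poly
    (algebraMap C[X] (FractionRing C[X]) (subst ζ (H.numer α e)) /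
      algebraMap C[X] (FractionRing C[X]) (subst ζ (H.denom α e))) *
    AdjoinRoot.root H.poly ^ (e : ℕ)

end Hyperelliptic

end Hyperelliptic

/-! ### Level varieties and level ideals -/

section Level

lemma exists_familyLcm {D : Type*} [CommRing D] [IsDomain D] [UniqueFactorizationMonoid D]
    {ι : Type*} [Fintype ι] (q : ι → D) :
    ∃ Λ : D, (∀ i, q i ∣ Λ) ∧ ∀ b, (∀ i, q i ∣ b) → Λ ∣ b := by
  classical
  let := UniqueFactorizationMonoid.toGCDMonoid D
  suffices h : ∀ t : Finset ι,
      ∃ Λ : D, (∀ i ∈ t, q i ∣ Λ) ∧ ∀ b, (∀ i ∈ t, q i ∣ b) → Λ ∣ b by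
    simpa using h Finset.univ
  intro t
  induction t using Finset.induction_on with
  | empty => exact ⟨1, by simp, fun b _ => one_dvd b⟩
  | insert a t _ ih =>
    obtain ⟨Λ, h1, h2⟩ := ih
    refine ⟨lcm (q a) Λ, fun i hi => ?_, fun b hb => ?_⟩
    · rcases Finset.mem_insert.mp hi with rfl | hi
      · exact dvd_lcm_left _ _
      · exact (h1 i hi).trans (dvd_lcm_right _ _)
    · exact lcm_dvd (hb a (Finset.mem_insert_self _ _))
        (h2 b fun i hi => hb i (Finset.mem_insert_of_mem hi))

/-- A least common multiple of a finite family in a factorial domain; it is unique up to a unit. -/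
def familyLcm {D : Type*} [CommRing D] [IsDomain D] [UniqueFactorizationMonoid D]
    {ι : Type*} [Fintype ι] (q : ι → D) : D :=
  (exists_familyLcm q).choose

lemma dvd_familyLcm {D : Type*} [CommRing D] [IsDomain D] [UniqueFactorizationMonoid D]
    {ι : Type*} [Fintype ι] (q : ι → D) (i : ι) : q i ∣ familyLcm q :=
  (exists_familyLcm q).choose_spec.1 i

lemma familyLcm_dvd {D : Type*} [CommRing D] [IsDomain D] [UniqueFactorizationMonoid D]
    {ι : Type*} [Fintype ι] (q : ι → D) (b : D) (h : ∀ i, q i ∣ b) : familyLcm q ∣ b :=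
  (exists_familyLcm q).choose_spec.2 b h

/-- The cofactor `D_i = lcm(q) / q_i`. -/
def cofactor {D : Type*} [CommRing D] [IsDomain D] [UniqueFactorizationMonoid D]
    {ι : Type*} [Fintype ι] (q : ι → D) (i : ι) : D :=
  (dvd_familyLcm q i).choose

lemma cofactor_spec {D : Type*} [CommRing D] [IsDomain D] [UniqueFactorizationMonoid D]
    {ι : Type*} [Fintype ι] (q : ι → D) (i : ι) : familyLcm q = q i * cofactor q i :=
  (dvd_familyLcm q i).choose_spec

variable {C : Type*} [Field C] [CharZero C] (H : Hyperelliptic C) {Θ : Type*} {n : ℕ}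
  (f : Fin (n - 1) → H.ParamExt Θ) (m : ℕ)

/-- The entry `σ_{k,j}` of the coefficient matrix of the homogeneous system attached to
`∂^n + f_2 ∂^(n-2) + ⋯ + f_n`, with entries in `C(Θ)⟨η⟩`. -/
def paramSigma (k : Fin (n - 1)) (j : gdIndex n m) : H.ParamExt Θ :=
  gdSigma (H.paramDeriv Θ) f k j

/-- The polynomials `p_j D_j ∈ C[Θ][η]` obtained from the `k`-th equation
`∑_j c_j σ_{k,j} = 0` by taking the coordinates `p_j / q_j` of the `σ_{k,j}` with respect to
`ν^e` and multiplying them by the least common multiple of the `q_j`. -/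
def rowPoly (k : Fin (n - 1)) (e : Fin 2) (j : gdIndex n m) : (MvPolynomial Θ C)[X] :=
  H.numer (paramSigma H f m k j) e *
    cofactor (fun i : gdIndex n m => H.denom (paramSigma H f m k i) e) j

/-- The rows of `S_Θ(n,m)`: the triples `(k, e, h)` for which `η^h` occurs in one of the
polynomials obtained from the `ν^e`-coordinate of the `k`-th equation. -/
def levelRows : Set (Fin (n - 1) × Fin 2 × ℕ) :=
  {r | ∃ j, (rowPoly H f m r.1 r.2.1 j).coeff r.2.2 ≠ 0}

/-- The matrix `S_Θ(n,m)` over `C(Θ)`. -/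
def levelMatrix :
    Matrix (levelRows H f m) (gdIndex n m) (FractionRing (MvPolynomial Θ C)) :=
  Matrix.of fun r j =>
    algebraMap (MvPolynomial Θ C) _ ((rowPoly H f m r.1.1 r.1.2.1 j).coeff r.1.2.2)

/-- The level ideal `I_m` of `C[Θ]`, generated by the numerators of the minors of size
`|J_{n,m}|` of `S_Θ(n,m)`. -/
def levelIdeal : Ideal (MvPolynomial Θ C) :=
  Ideal.span (Set.range fun r : gdIndex n m ↪ levelRows H f m =>
    IsFractionRing.num (MvPolynomial Θ C) ((levelMatrix H f m).submatrix r id).det)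

/-- The parameter values at which `∂^n + f_2 ∂^(n-2) + ⋯ + f_n` can be specialized. -/
def admissible : Set (Θ → C) := {ζ | ∀ i, H.RegularAt ζ (f i)}

/-- The level variety `X_m`: the parameter values `ζ` for which the specialized operator, with
coefficients `f_i(ζ)` in `C⟨η⟩`, is defined and has `V_m ≠ 0`. -/
def levelVariety : Set (Θ → C) :=
  {ζ | ζ ∈ admissible H f ∧ gdV H.deriv (fun i => H.specialize ζ (f i)) m ≠ ⊥}

end Level

end

/-! ### Linear algebra: kernels and maximal minors -/

noncomputable section

/-! Fix an admissible `ζ`. The substitution `Θ ↦ ζ` should commute with sums, products and the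
derivation, and hence carry `σ_{k,j}` of the operator over `C(Θ)⟨η⟩` to `σ_{k,j}` of the specialized
operator. Since it is defined only on elements regular at `ζ`, it is handled through its graph:
`substGraph` is a subring of `C(Θ)(η) × C(η)`, and `specGraph` is the subring of `C(Θ)⟨η⟩ × C⟨η⟩`
that it generates together with the pair of roots `ν`. The latter contains all pairs `(f_i, f_i(ζ))`
and is stable under the derivation (`deriv_mem_specGraph`), so it contains the pairs of `σ_{k,j}`
(`gdSigma_mem_specGraph`). Returning to coordinates (`coord_mem_substGraph`, `substGraph_num_den`),
the reduced denominators of the `σ_{k,j}` survive at `ζ`, and the specialized values are read off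
from the reduced fractions.

Consequently the least common denominators survive too, and multiplying by them loses nothing.
Comparing coefficients of `η^h` identifies `V_m` of the specialized operator with the kernel of
`S_Θ(n,m)` evaluated at `ζ` (`sum_smul_gdSigma_eq_zero_iff`). By the lemma below this kernel is
nonzero iff all maximal minors vanish; with fewer rows than columns there are no minors and the
kernel is nonzero. Determinants commute with evaluation, which gives the equation for the level
variety. The inclusion of successive level varieties comes from extending solutions by zero. -/

lemma exists_mulVec_eq_zero_iff_forall_minor {K : Type*} [Field K] {ι J : Type*} [Fintype J]
    [DecidableEq J] (M : Matrix ι J K) :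
    (∃ c : J → K, c ≠ 0 ∧ ∀ i, ∑ j, c j * M i j = 0) ↔
      ∀ r : J ↪ ι, (M.submatrix r id).det = 0 := by
  constructor
  · rintro ⟨c, hc, h⟩ r
    refine Matrix.exists_mulVec_eq_zero_iff.mp ⟨c, hc, funext fun i => ?_⟩
    rw [Pi.zero_apply, ← h (r i)]
    exact Finset.sum_congr rfl fun j _ => mul_comm _ _
  · intro h
    by_contra! hc
    -- If the rows did not span, they would lie in the kernel of a nonzero functional, whose
    -- coordinates form a nonzero solution `c`.
    have hspan : Submodule.span K (Set.range M.row) = ⊤ := by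
      by_contra hne
      obtain ⟨φ, hφ, hle⟩ := Submodule.exists_le_ker_of_lt_top _ (lt_top_iff_ne_top.mpr hne)
      have hφ' : ∀ v : J → K, φ v = ∑ j, φ (Pi.single j 1) * v j := by
        intro v
        rw [LinearMap.pi_apply_eq_sum_univ φ v]
        refine Finset.sum_congr rfl fun j _ => ?_
        rw [smul_eq_mul, mul_comm]
        congr 2
        ext i
        simp [Pi.single_apply, eq_comm]
      obtain ⟨i, hi⟩ := hc (fun j => φ (Pi.single j 1)) (by
        intro h0
        apply hφ
        ext v
        simpa using congrFun h0 v)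
      exact hi ((hφ' _).symm.trans (hle (Submodule.subset_span ⟨i, rfl⟩)))
    -- A basis selected among the rows has as many members as there are columns, so it yields an
    -- invertible square submatrix.
    obtain ⟨κ, a, ha, hs, hli⟩ := exists_linearIndependent' K M.row
    rw [hspan] at hs
    let b := Module.Basis.mk hli hs.ge
    have e : J ≃ κ := (Pi.basisFun K J).indexEquiv b
    have hunit := Matrix.linearIndependent_rows_iff_isUnit.mp
      (show LinearIndependent K (M.submatrix (fun j => a (e j)) id).row from hli.comp e e.injective)
    exact (Matrix.isUnit_iff_isUnit_det _ |>.mp hunit).ne_zero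
      (h ⟨fun j => a (e j), ha.comp e.injective⟩)

/-! ### Substitution of parameters in rational functions -/

namespace Hyperelliptic

variable {C : Type*} [Field C] {Θ : Type*} (ζ : Θ → C)

/-- The graph of the substitution `Θ ↦ ζ` on the fractions in `C(Θ)(η)` that are regular at
`ζ`. -/
def substGraph : Subring (FractionRing (MvPolynomial Θ C)[X] × FractionRing C[X]) where
  carrier := {z | ∃ p q : (MvPolynomial Θ C)[X], subst ζ q ≠ 0 ∧
    z.1 * algebraMap _ _ q = algebraMap _ _ p ∧
    z.2 * algebraMap _ _ (subst ζ q) = algebraMap _ _ (subst ζ p)}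
  one_mem' := ⟨1, 1, by simp⟩
  zero_mem' := ⟨0, 1, by simp⟩
  mul_mem' := by
    rintro z w ⟨p, q, hq, h1, h2⟩ ⟨p', q', hq', h1', h2'⟩
    refine ⟨p * p', q * q', by simp [hq, hq'], ?_, ?_⟩ <;>
      simp only [map_mul, Prod.fst_mul, Prod.snd_mul]
    · rw [← h1, ← h1']; ring
    · rw [← h2, ← h2']; ring
  add_mem' := by
    rintro z w ⟨p, q, hq, h1, h2⟩ ⟨p', q', hq', h1', h2'⟩
    refine ⟨p * q' + p' * q, q * q', by simp [hq, hq'], ?_, ?_⟩ <;>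
      simp only [map_mul, map_add, Prod.fst_add, Prod.snd_add]
    · rw [← h1, ← h1']; ring
    · rw [← h2, ← h2']; ring
  neg_mem' := by
    rintro z ⟨p, q, hq, h1, h2⟩
    exact ⟨-p, q, hq, by simp [← h1], by simp [← h2]⟩

variable {ζ}

lemma mem_substGraph {x : FractionRing (MvPolynomial Θ C)[X]} {y : FractionRing C[X]} :
    (x, y) ∈ substGraph ζ ↔ ∃ p q : (MvPolynomial Θ C)[X], subst ζ q ≠ 0 ∧
      x * algebraMap _ _ q = algebraMap _ _ p ∧
      y * algebraMap _ _ (subst ζ q) = algebraMap _ _ (subst ζ p) := Iff.rfl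

lemma derivative_subst (p : (MvPolynomial Θ C)[X]) :
    derivative (subst ζ p) = subst ζ (derivative p) :=
  Polynomial.derivative_map p _

/-- This is the quotient rule: the new denominator `q * q` still survives the substitution because
`C[η]` is a domain. -/
lemma etaDeriv_mem_substGraph {x : FractionRing (MvPolynomial Θ C)[X]} {y : FractionRing C[X]}
    (h : (x, y) ∈ substGraph ζ) : (etaDeriv _ x, etaDeriv _ y) ∈ substGraph ζ := by
  obtain ⟨p, q, hq, h1, h2⟩ := h
  have d1 := congrArg (etaDeriv _) h1
  have d2 := congrArg (etaDeriv _) h2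
  simp only [Derivation.leibniz, etaDeriv_algebraMap, smul_eq_mul, derivative_subst] at d1 d2
  refine ⟨derivative p * q - p * derivative q, q * q, by simp [hq], ?_, ?_⟩ <;>
    simp only [map_mul, map_sub]
  · linear_combination algebraMap _ _ q * d1 - algebraMap _ _ (derivative q) * h1
  · linear_combination algebraMap _ _ (subst ζ q) * d2 -
      algebraMap _ _ (subst ζ (derivative q)) * h2

lemma subst_map_C (p : C[X]) : subst ζ (p.map (MvPolynomial.C (σ := Θ))) = p := by
  change (p.map _).map _ = p
  rw [Polynomial.map_map]
  convert Polynomial.map_id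
  ext c
  simp

lemma incl_algebraMap (p : C[X]) : incl C Θ (algebraMap _ _ p) =
    algebraMap _ _ (p.map (MvPolynomial.C (σ := Θ))) := by
  unfold incl IsFractionRing.map
  rw [IsLocalization.map_eq]
  rfl

/-- A fraction in `C(η)` involves no parameters, so substitution fixes its numerator and
denominator. -/
lemma incl_mem_substGraph (c : FractionRing C[X]) : (incl C Θ c, c) ∈ substGraph ζ := by
  obtain ⟨p, q, hq, rfl⟩ := IsFractionRing.div_surjective (A := C[X]) c
  have hq0 : q ≠ 0 := nonZeroDivisors.ne_zero hq
  have hq1 : algebraMap C[X] (FractionRing C[X]) q ≠ 0 := by simpa using hq0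
  refine ⟨p.map MvPolynomial.C, q.map MvPolynomial.C, by rwa [subst_map_C], ?_, ?_⟩
  · rw [← incl_algebraMap, ← incl_algebraMap, ← map_mul, div_mul_cancel₀ _ hq1]
  · rw [subst_map_C, subst_map_C, div_mul_cancel₀ _ hq1]

/-- A fraction in the graph of the substitution is regular in lowest terms, and its value is
computed from its lowest terms. -/
lemma substGraph_num_den {x : FractionRing (MvPolynomial Θ C)[X]} {y : FractionRing C[X]}
    (h : (x, y) ∈ substGraph ζ) :
    subst ζ (IsFractionRing.den (MvPolynomial Θ C)[X] x : (MvPolynomial Θ C)[X]) ≠ 0 ∧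
    y * algebraMap _ _ (subst ζ (IsFractionRing.den (MvPolynomial Θ C)[X] x :
      (MvPolynomial Θ C)[X])) =
      algebraMap _ _ (subst ζ (IsFractionRing.num (MvPolynomial Θ C)[X] x)) := by
  obtain ⟨p, q, hq, h1, h2⟩ := h
  set N := IsFractionRing.num (MvPolynomial Θ C)[X] x
  set D := (IsFractionRing.den (MvPolynomial Θ C)[X] x : (MvPolynomial Θ C)[X])
  have hD : algebraMap _ (FractionRing (MvPolynomial Θ C)[X]) D ≠ 0 := by simp [D]
  have hx : x * algebraMap _ _ D = algebraMap _ _ N := by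
    rw [← eq_div_iff hD]
    exact (IsFractionRing.mk'_num_den' _ x).symm
  have hpq : p * D = N * q := by
    apply IsFractionRing.injective (MvPolynomial Θ C)[X] (FractionRing (MvPolynomial Θ C)[X])
    rw [map_mul, map_mul, ← h1, ← hx]
    ring
  -- The reduced denominator is coprime to the numerator, hence divides every other denominator; one
  -- that survives at `ζ` therefore forces `D` to survive.
  obtain ⟨t, ht⟩ : D ∣ q :=
    IsRelPrime.dvd_of_dvd_mul_left
      (IsFractionRing.num_den_reduced (MvPolynomial Θ C)[X] x).symm (Dvd.intro_left _ hpq)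
  have hD0 : subst ζ D ≠ 0 := by
    intro h0
    apply hq
    rw [ht, map_mul, h0, zero_mul]
  refine ⟨hD0, ?_⟩
  have hq' : algebraMap C[X] (FractionRing C[X]) (subst ζ q) ≠ 0 := by simpa using hq
  apply mul_right_cancel₀ hq'
  have := congrArg (fun r => algebraMap C[X] (FractionRing C[X]) (subst ζ r)) hpq
  simp only [map_mul] at this
  rw [← this, ← h2]
  ring

/-! ### Specialization in the hyperelliptic extension -/

variable (ζ) in
/-- The graph of the specialization `Θ ↦ ζ` on the elements of `C(Θ)⟨η⟩` that are regular at
`ζ`. -/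
def specGraph (H : Hyperelliptic C) : Subring (H.ParamExt Θ × H.Ext) :=
  ((((AdjoinRoot.mk (H.paramPoly Θ)).comp
      (Polynomial.mapRingHom ((RingHom.fst _ _).comp (substGraph ζ).subtype))).prod
    ((AdjoinRoot.mk H.poly).comp
      (Polynomial.mapRingHom ((RingHom.snd _ _).comp (substGraph ζ).subtype)))) :
    (substGraph ζ)[X] →+* H.ParamExt Θ × H.Ext).range

variable {H : Hyperelliptic C}

lemma mk_mem_specGraph {F : (FractionRing (MvPolynomial Θ C)[X])[X]} {G : (FractionRing C[X])[X]}
    (h : ∀ i, (F.coeff i, G.coeff i) ∈ substGraph ζ) :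
    (AdjoinRoot.mk (H.paramPoly Θ) F, AdjoinRoot.mk H.poly G) ∈ specGraph ζ H := by
  -- The range bounds both degrees, so a single polynomial over `substGraph ζ` projects to `F` and
  -- to `G`.
  refine ⟨∑ i ∈ Finset.range (F.natDegree + G.natDegree + 1),
    monomial i ⟨(F.coeff i, G.coeff i), h i⟩, ?_⟩
  refine Prod.ext (congrArg (AdjoinRoot.mk (H.paramPoly Θ)) ?_)
    (congrArg (AdjoinRoot.mk H.poly) ?_)
  · rw [map_sum]
    simp only [coe_mapRingHom, map_monomial]
    exact (F.as_sum_range' _ (by omega)).symm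
  · rw [map_sum]
    simp only [coe_mapRingHom, map_monomial]
    exact (G.as_sum_range' _ (by omega)).symm

lemma of_mem_specGraph {x : FractionRing (MvPolynomial Θ C)[X]} {y : FractionRing C[X]}
    (h : (x, y) ∈ substGraph ζ) :
    (AdjoinRoot.of (H.paramPoly Θ) x, AdjoinRoot.of H.poly y) ∈ specGraph ζ H := by
  refine mk_mem_specGraph (F := Polynomial.C x) (G := Polynomial.C y) fun i => ?_
  rw [coeff_C, coeff_C]
  split_ifs
  exacts [h, zero_mem _]

lemma root_mem_specGraph :
    (AdjoinRoot.root (H.paramPoly Θ), AdjoinRoot.root H.poly) ∈ specGraph ζ H := by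
  refine mk_mem_specGraph (F := X) (G := X) fun i => ?_
  rw [coeff_X, coeff_X]
  split_ifs
  exacts [one_mem _, zero_mem _]

/-- The coordinates of `α_0 + α_1 ν ∈ C⟨η⟩`. -/
def extCoord (H : Hyperelliptic C) (e : ℕ) : H.Ext →ₗ[FractionRing C[X]] FractionRing C[X] :=
  (lcoeff _ e).comp (AdjoinRoot.modByMonicHom H.monic)

/-- The remainder modulo a nonconstant polynomial of degree at most two has no coefficients beyond
the first two. -/
lemma ext_eq_zero_iff (β : H.Ext) : β = 0 ↔ ∀ e : Fin 2, H.extCoord e β = 0 := by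
  refine ⟨fun h e => by rw [h, map_zero], fun h => ?_⟩
  rw [← AdjoinRoot.mk_leftInverse H.monic β]
  convert map_zero (AdjoinRoot.mk H.poly)
  ext i
  rw [coeff_zero]
  rcases lt_or_ge i 2 with hi | hi
  · exact h ⟨i, hi⟩
  · obtain ⟨g, rfl⟩ := AdjoinRoot.mk_surjective β
    rw [AdjoinRoot.modByMonicHom_mk]
    refine coeff_eq_zero_of_natDegree_lt
      ((natDegree_modByMonic_lt _ H.monic fun h1 => H.irreducible.not_isUnit ?_).trans_le
        (H.natDegree_le.trans hi))
    rw [h1]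
    exact isUnit_one

/-- Coordinates are coefficients of remainders, and division by a monic polynomial commutes with
ring homomorphisms. It can thus be done once over `substGraph ζ` and then projected to both factors.
-/
lemma coord_mem_substGraph {α : H.ParamExt Θ} {β : H.Ext} (h : (α, β) ∈ specGraph ζ H)
    (e : Fin 2) : (H.coord α e, H.extCoord e β) ∈ substGraph ζ := by
  obtain ⟨Φ, hΦ⟩ := h
  obtain ⟨rfl, rfl⟩ := Prod.ext_iff.mp hΦ
  -- The map `c ↦ (c, c)` lifts the minimal polynomial of `ν` to `substGraph ζ`; its projections are
  -- the two minimal polynomials.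
  let ι : FractionRing C[X] →+* substGraph ζ :=
    ((incl C Θ).prod (RingHom.id _)).codRestrict _ incl_mem_substGraph
  have h1 : (H.poly.map ι).map ((RingHom.fst _ _).comp (substGraph ζ).subtype) =
      H.paramPoly Θ := by
    rw [Polynomial.map_map]; rfl
  have h2 : (H.poly.map ι).map ((RingHom.snd _ _).comp (substGraph ζ).subtype) = H.poly := by
    rw [Polynomial.map_map]; exact Polynomial.map_id
  have hm : (H.poly.map ι).Monic := H.monic.map ι
  have key : ((Φ %ₘ H.poly.map ι).coeff e : FractionRing (MvPolynomial Θ C)[X] × FractionRing C[X])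
      = (H.coord (AdjoinRoot.mk (H.paramPoly Θ)
          (Φ.map ((RingHom.fst _ _).comp (substGraph ζ).subtype))) e,
        H.extCoord e (AdjoinRoot.mk H.poly
          (Φ.map ((RingHom.snd _ _).comp (substGraph ζ).subtype)))) := by
    refine Prod.ext ?_ ?_
    · simp only [coord, AdjoinRoot.modByMonicHom_mk]
      conv_rhs => rw [show H.poly.map (incl C Θ) = _ from h1.symm]
      rw [← map_modByMonic _ hm, coeff_map]
      rfl
    · simp only [extCoord, LinearMap.comp_apply, AdjoinRoot.modByMonicHom_mk, lcoeff_apply]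
      conv_rhs => rw [← h2]
      rw [← map_modByMonic _ hm, coeff_map]
      rfl
  exact key ▸ ((Φ %ₘ H.poly.map ι).coeff e).2

lemma eq_sum_coord (α : H.ParamExt Θ) :
    α = ∑ e : Fin 2, AdjoinRoot.of (H.paramPoly Θ) (H.coord α e) *
      AdjoinRoot.root (H.paramPoly Θ) ^ (e : ℕ) := by
  conv_lhs => rw [← AdjoinRoot.mk_leftInverse (H.monic.map (incl C Θ)) α]
  have hlt : (AdjoinRoot.modByMonicHom (H.monic.map (incl C Θ)) α).natDegree < 2 := by
    obtain ⟨g, rfl⟩ := AdjoinRoot.mk_surjective α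
    rw [AdjoinRoot.modByMonicHom_mk]
    refine (natDegree_modByMonic_lt _ (H.monic.map _) fun h1 => ?_).trans_le
      ((natDegree_map_le).trans H.natDegree_le)
    have h2 := congrArg natDegree h1
    rw [H.monic.natDegree_map, natDegree_one] at h2
    exact H.irreducible.natDegree_pos.ne' h2
  conv_lhs => rw [as_sum_range_C_mul_X_pow' _ hlt]
  rw [map_sum, Finset.sum_range]
  exact Finset.sum_congr rfl fun e _ => by simp [coord]

lemma specialize_mem_specGraph {α : H.ParamExt Θ} (h : H.RegularAt ζ α) :
    (α, H.specialize ζ α) ∈ specGraph ζ H := by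
  have : (α, H.specialize ζ α) = ∑ e : Fin 2,
      (AdjoinRoot.of (H.paramPoly Θ) (H.coord α e), AdjoinRoot.of H.poly
    (algebraMap C[X] (FractionRing C[X]) (subst ζ (H.numer α e)) /
      algebraMap C[X] (FractionRing C[X]) (subst ζ (H.denom α e)))) *
      (AdjoinRoot.root (H.paramPoly Θ), AdjoinRoot.root H.poly) ^ (e : ℕ) := by
    refine Prod.ext ?_ ?_
    · rw [Prod.fst_sum]; exact eq_sum_coord α
    · rw [Prod.snd_sum]; rfl
  rw [this]
  refine sum_mem fun e _ => mul_mem (of_mem_specGraph ?_) (pow_mem root_mem_specGraph _)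
  refine ⟨H.numer α e, H.denom α e, h e, ?_, ?_⟩
  · have hD : algebraMap _ (FractionRing (MvPolynomial Θ C)[X]) (H.denom α e) ≠ 0 := by
      simp [denom]
    rw [← eq_div_iff hD]
    exact (IsFractionRing.mk'_num_den' _ _).symm
  · exact div_mul_cancel₀ _ (by simpa using h e)

lemma exists_mk_of_mem_specGraph {α : H.ParamExt Θ} {β : H.Ext}
    (h : (α, β) ∈ specGraph ζ H) :
    ∃ (F : (FractionRing (MvPolynomial Θ C)[X])[X]) (G : (FractionRing C[X])[X]),
      (∀ i, (F.coeff i, G.coeff i) ∈ substGraph ζ) ∧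
      AdjoinRoot.mk (H.paramPoly Θ) F = α ∧ AdjoinRoot.mk H.poly G = β := by
  obtain ⟨Φ, hΦ⟩ := h
  obtain ⟨h1, h2⟩ := Prod.ext_iff.mp hΦ
  refine ⟨_, _, fun i => ?_, h1, h2⟩
  rw [coe_mapRingHom, coe_mapRingHom, coeff_map, coeff_map]
  exact (Φ.coeff i).2

lemma coeff_mul_mem_substGraph {F F' : (FractionRing (MvPolynomial Θ C)[X])[X]}
    {G G' : (FractionRing C[X])[X]} (h : ∀ i, (F.coeff i, G.coeff i) ∈ substGraph ζ)
    (h' : ∀ i, (F'.coeff i, G'.coeff i) ∈ substGraph ζ) (i : ℕ) :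
    ((F * F').coeff i, (G * G').coeff i) ∈ substGraph ζ := by
  rw [show ((F * F').coeff i, (G * G').coeff i) =
      ∑ x ∈ Finset.HasAntidiagonal.antidiagonal i,
        (F.coeff x.1, G.coeff x.1) * (F'.coeff x.2, G'.coeff x.2) from
    Prod.ext (by rw [Prod.fst_sum]; exact coeff_mul _ _ _)
      (by rw [Prod.snd_sum]; exact coeff_mul _ _ _)]
  exact sum_mem fun x _ => mul_mem (h x.1) (h' x.2)

lemma coeff_X_mem_substGraph (i : ℕ) :
    ((X : (FractionRing (MvPolynomial Θ C)[X])[X]).coeff i,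
      (X : (FractionRing C[X])[X]).coeff i) ∈ substGraph ζ := by
  rw [coeff_X, coeff_X]
  split_ifs
  exacts [one_mem _, zero_mem _]

lemma algebraMap_mem_specGraph (c : C) :
    (algebraMap C (H.ParamExt Θ) c, algebraMap C H.Ext c) ∈ specGraph ζ H := by
  have := of_mem_specGraph (H := H) (incl_mem_substGraph (ζ := ζ)
    (algebraMap C[X] (FractionRing C[X]) (Polynomial.C c)))
  rw [incl_algebraMap, map_C] at this
  exact this

/-! ### Compatibility of specialization with the derivations -/

section Deriv

variable [CharZero C]

/-- On representatives both derivations are `F ↦ Y F_η + w F'`, with `w` built from the minimal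
polynomial and an inverse of its derivative. Both of these data over `C(Θ)(η)` are images of those
over `C(η)`, so all coefficients occurring in the formula are paired in `substGraph ζ`. -/
lemma deriv_mem_specGraph {α : H.ParamExt Θ} {β : H.Ext} (h : (α, β) ∈ specGraph ζ H) :
    (H.paramDeriv Θ α, H.deriv β) ∈ specGraph ζ H := by
  obtain ⟨F, G, hFG, rfl, rfl⟩ := exists_mk_of_mem_specGraph h
  have hP : ∀ i, ((H.paramPoly Θ).coeff i, H.poly.coeff i) ∈ substGraph ζ := fun i => by
    rw [paramPoly, coeff_map]
    exact incl_mem_substGraph _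
  have hs : ∀ i, ((H.inverse.map (incl C Θ)).coeff i, H.inverse.coeff i) ∈ substGraph ζ :=
    fun i => by
      rw [coeff_map]
      exact incl_mem_substGraph _
  have hδ : ∀ {F : (FractionRing (MvPolynomial Θ C)[X])[X]} {G : (FractionRing C[X])[X]},
      (∀ i, (F.coeff i, G.coeff i) ∈ substGraph ζ) → ∀ i,
        ((X * PolynomialModule.equivPolynomialSelf ((etaDeriv _).mapCoeffs F)).coeff i,
          (X * PolynomialModule.equivPolynomialSelf ((etaDeriv _).mapCoeffs G)).coeff i) ∈
          substGraph ζ := by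
    intro F G h
    refine coeff_mul_mem_substGraph coeff_X_mem_substGraph fun i => ?_
    exact etaDeriv_mem_substGraph (h i)
  have hw : ∀ i, ((nuDeriv (H.paramPoly Θ) (H.inverse.map (incl C Θ))).coeff i,
      (nuDeriv H.poly H.inverse).coeff i) ∈ substGraph ζ := fun i => by
    rw [nuDeriv, nuDeriv, coeff_neg, coeff_neg]
    exact (substGraph ζ).neg_mem (x := (_, _)) (coeff_mul_mem_substGraph hs (hδ hP) i)
  have hd : ∀ i, ((derivative F).coeff i, (derivative G).coeff i) ∈ substGraph ζ := fun i => by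
    rw [coeff_derivative, coeff_derivative]
    exact (substGraph ζ).mul_mem (x := (_, _)) (y := (_, _)) (hFG _)
      (by exact_mod_cast natCast_mem (substGraph ζ) (i + 1))
  have hdvd : H.paramPoly Θ ∣
      derivative (H.paramPoly Θ) * H.inverse.map (incl C Θ) - 1 := by
    simpa [Polynomial.derivative_map] using Polynomial.map_dvd (incl C Θ) H.inverse_spec
  have e1 : H.paramDeriv Θ (AdjoinRoot.mk (H.paramPoly Θ) F) = _ := hypDeriv_mk _ _ hdvd F
  have e2 : H.deriv (AdjoinRoot.mk H.poly G) = _ := hypDeriv_mk _ _ H.inverse_spec G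
  rw [e1, e2]
  exact mk_mem_specGraph fun i => (substGraph ζ).add_mem (x := (_, _)) (y := (_, _)) (hδ hFG i)
    (coeff_mul_mem_substGraph hw hd i)

lemma iterate_deriv_mem_specGraph {α : H.ParamExt Θ} {β : H.Ext}
    (h : (α, β) ∈ specGraph ζ H) (k : ℕ) :
    ((H.paramDeriv Θ)^[k] α, H.deriv^[k] β) ∈ specGraph ζ H := by
  induction k with
  | zero => exact h
  | succ k ih =>
    rw [Function.iterate_succ_apply', Function.iterate_succ_apply']
    exact deriv_mem_specGraph ih

lemma specDiffPoly_mem_specGraph {n : ℕ} {v : Fin (n - 1) → H.ParamExt Θ}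
    {w : Fin (n - 1) → H.Ext} (h : ∀ i, (v i, w i) ∈ specGraph ζ H) (g : DiffPoly C n) :
    (specDiffPoly (H.paramDeriv Θ) v g, specDiffPoly H.deriv w g) ∈ specGraph ζ H := by
  induction g using MvPolynomial.induction_on with
  | C a =>
    simp only [specDiffPoly, MvPolynomial.aeval_C]
    exact algebraMap_mem_specGraph a
  | add p q hp hq =>
    rw [map_add, map_add]
    exact add_mem hp hq
  | mul_X p i hp =>
    rw [map_mul, map_mul]
    refine (specGraph ζ H).mul_mem (x := (_, _)) (y := (_, _)) hp ?_
    simp only [specDiffPoly, MvPolynomial.aeval_X]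
    exact iterate_deriv_mem_specGraph (h i.1) i.2

end Deriv

end Hyperelliptic

/-- The chosen numerator of a ring element is determined only up to a unit, which does not affect
whether it vanishes at a point. -/
lemma associated_num_algebraMap {A K : Type*} [CommRing A] [IsDomain A]
    [UniqueFactorizationMonoid A] [Field K] [Algebra A K] [IsFractionRing A K] (a : A) :
    Associated (IsFractionRing.num A (algebraMap A K a)) a := by
  exact (IsFractionRing.num_den_unique A (algebraMap A K a) a 1 isRelPrime_one_right
    (IsLocalization.mk'_one K a)).1

/-! ### Level varieties as zero loci of level ideals -/

section Level

open Hyperelliptic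

/-- The least common multiple divides the product, whose image is nonzero since `C[η]` is a domain.
-/
lemma subst_familyLcm_ne_zero {C : Type*} [Field C] {Θ : Type*} {ι : Type*} [Fintype ι] {ζ : Θ → C}
    {q : ι → (MvPolynomial Θ C)[X]} (hq : ∀ i, subst ζ (q i) ≠ 0) :
    subst ζ (familyLcm q) ≠ 0 := by
  intro h
  obtain ⟨g, hg⟩ := familyLcm_dvd q (∏ i, q i) fun i => Finset.dvd_prod_of_mem q (Finset.mem_univ i)
  have h1 := congrArg (subst ζ) hg
  rw [map_mul, h, zero_mul, map_prod] at h1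
  exact Finset.prod_ne_zero_iff.mpr (fun i _ => hq i) h1

variable {C : Type*} [Field C] [CharZero C] (H : Hyperelliptic C) {Θ : Type*} {n : ℕ}
  (f : Fin (n - 1) → H.ParamExt Θ) (m : ℕ)

variable {f} {ζ : Θ → C}

lemma gdSigma_mem_specGraph (hζ : ζ ∈ admissible H f) (k : Fin (n - 1)) (j : ℕ) :
    (gdSigma (H.paramDeriv Θ) f k j,
      gdSigma H.deriv (fun i => H.specialize ζ (f i)) k j) ∈ specGraph ζ H :=
  specDiffPoly_mem_specGraph (fun i => specialize_mem_specGraph (hζ i)) _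

/-- The `k`-th specialized equation holds iff the specialized rows of `S_Θ(n,m)` coming from it
vanish on `c`. -/
lemma sum_smul_gdSigma_eq_zero_iff (hζ : ζ ∈ admissible H f) (k : Fin (n - 1))
    (c : gdIndex n m → C) :
    ∑ j, c j • gdSigma H.deriv (fun i => H.specialize ζ (f i)) k j = 0 ↔
      ∀ (e : Fin 2) (h : ℕ), ∑ j, c j *
        MvPolynomial.eval ζ ((rowPoly H f m k e j).coeff h) = 0 := by
  rw [ext_eq_zero_iff]
  refine forall_congr' fun e => ?_
  -- For each `j`, the reduced denominator of the `ν^e`-coordinate of `σ_{k,j}` survives at `ζ`, and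
  -- the coordinate of the specialized `σ_{k,j}` is the substituted fraction.
  have hcoord : ∀ j : gdIndex n m, _ := fun j =>
    substGraph_num_den (coord_mem_substGraph (gdSigma_mem_specGraph H hζ k j) e)
  set q : gdIndex n m → (MvPolynomial Θ C)[X] := fun j => H.denom (paramSigma H f m k j) e
  have hΛ : subst ζ (familyLcm q) ≠ 0 :=
    subst_familyLcm_ne_zero fun j => (hcoord j).1
  have hΛ' : algebraMap C[X] (FractionRing C[X]) (subst ζ (familyLcm q)) ≠ 0 := by simpa using hΛ
  have hrow : ∀ j : gdIndex n m,
      H.extCoord e (gdSigma H.deriv (fun i => H.specialize ζ (f i)) k j) *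
        algebraMap C[X] (FractionRing C[X]) (subst ζ (familyLcm q)) =
      algebraMap C[X] (FractionRing C[X]) (subst ζ (rowPoly H f m k e j)) := by
    intro j
    rw [cofactor_spec q j, map_mul, map_mul, ← mul_assoc]
    change _ = algebraMap _ _ (subst ζ (H.numer _ _ * cofactor q j))
    rw [map_mul, map_mul]
    congr 1
    exact (hcoord j).2
  have hsum : H.extCoord e
      (∑ j : gdIndex n m, c j • gdSigma H.deriv (fun i => H.specialize ζ (f i)) k j) *
        algebraMap C[X] (FractionRing C[X]) (subst ζ (familyLcm q)) =
      algebraMap C[X] (FractionRing C[X])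
        (∑ j : gdIndex n m, Polynomial.C (c j) * subst ζ (rowPoly H f m k e j)) := by
    rw [map_sum, map_sum, Finset.sum_mul]
    refine Finset.sum_congr rfl fun j _ => ?_
    rw [map_mul, ← hrow j, ← mul_assoc]
    congr 1
    rw [← smul_eq_mul, ← map_smul, Algebra.smul_def, Algebra.smul_def]
    rfl
  -- Multiplication by the nonzero common denominator turns the equation into a polynomial identity
  -- in `η`, which is tested coefficientwise.
  rw [← mul_eq_zero_iff_right hΛ', hsum, map_eq_zero_iff _ (IsFractionRing.injective _ _),
    Polynomial.ext_iff]
  refine forall_congr' fun h => ?_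
  rw [finsetSum_coeff, coeff_zero]
  simp only [coeff_C_mul]
  simp [subst, coeff_map]

variable (f)

/-- The matrix `S_Θ(n,m)` over `C[Θ]`. -/
def levelPolyMatrix : Matrix (levelRows H f m) (gdIndex n m) (MvPolynomial Θ C) :=
  Matrix.of fun r j => (rowPoly H f m r.1.1 r.1.2.1 j).coeff r.1.2.2

variable {f}

/-- The minors already lie in `C[Θ]`, so their numerators are associated to them, and evaluation at
`ζ` commutes with determinants. -/
lemma mem_zeroLocus_levelIdeal_iff :
    ζ ∈ MvPolynomial.zeroLocus C (levelIdeal H f m) ↔ ∀ r : gdIndex n m ↪ levelRows H f m,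
      (((levelPolyMatrix H f m).map (MvPolynomial.eval ζ)).submatrix r id).det = 0 := by
  rw [levelIdeal, MvPolynomial.zeroLocus_span]
  simp only [Set.forall_mem_range, Set.mem_ofPred_eq]
  refine forall_congr' fun r => ?_
  have h1 : ((levelMatrix H f m).submatrix r id).det =
      algebraMap _ _ ((levelPolyMatrix H f m).submatrix r id).det := by
    rw [RingHom.map_det]; rfl
  have h2 : (((levelPolyMatrix H f m).map (MvPolynomial.eval ζ)).submatrix r id).det =
      MvPolynomial.eval ζ ((levelPolyMatrix H f m).submatrix r id).det := by
    rw [RingHom.map_det]; rfl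
  rw [h1, h2, MvPolynomial.aeval_eq_eval]
  exact ((associated_num_algebraMap _).map (MvPolynomial.eval ζ)).eq_zero_iff

lemma levelVariety_eq :
    levelVariety H f m = admissible H f ∩ MvPolynomial.zeroLocus C (levelIdeal H f m) := by
  ext ζ
  refine and_congr_right fun hζ => ?_
  rw [mem_zeroLocus_levelIdeal_iff, ← exists_mulVec_eq_zero_iff_forall_minor,
    Submodule.ne_bot_iff]
  refine exists_congr fun c => ?_
  rw [and_comm]
  refine and_congr_right fun _ => ?_
  refine (forall_congr' fun k => sum_smul_gdSigma_eq_zero_iff H m hζ k c).trans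
    ⟨fun h r => h r.1.1 r.1.2.1 r.1.2.2, fun h k e i => ?_⟩
  -- A triple that is not a row has zero coefficients over `C[Θ]`, so its equation is trivial at
  -- every `ζ`.
  by_cases hr : (k, e, i) ∈ levelRows H f m
  · exact h ⟨_, hr⟩
  · refine Finset.sum_eq_zero fun j _ => ?_
    have : (rowPoly H f m k e j).coeff i = 0 := by
      by_contra h0
      exact hr ⟨j, h0⟩
    rw [this, map_zero, mul_zero]

end Level

/-! ### Monotonicity in the level -/

lemma gdV_ne_bot_mono {C : Type*} [Field C] {R : Type*} [CommRing R] [Algebra C R] {n : ℕ}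
    (δ : Derivation C R R) (v : Fin (n - 1) → R) {m m' : ℕ} (hm : m ≤ m')
    (h : gdV δ v m ≠ ⊥) : gdV δ v m' ≠ ⊥ := by
  have hsub : gdIndex n m ⊆ gdIndex n m' :=
    Finset.filter_subset_filter _ (Finset.Icc_subset_Icc_right hm)
  rw [Submodule.ne_bot_iff] at h ⊢
  obtain ⟨c, hc, hc0⟩ := h
  -- Since `σ_{k,j}` does not depend on `m`, a solution stays a solution when extended by zero to
  -- the larger index set.
  let c' : ℕ → C := fun j => if hj : j ∈ gdIndex n m then c ⟨j, hj⟩ else 0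
  have hc' : ∀ j : gdIndex n m, c' j = c j := fun j => dif_pos j.2
  refine ⟨fun j => c' j, fun k => ?_, fun h0 => hc0 (funext fun j => ?_)⟩
  · rw [← hc k, Finset.sum_coe_sort (gdIndex n m') fun j => c' j • gdSigma δ v k j]
    rw [← Finset.sum_subset hsub fun j _ hj => by simp [c', hj],
      ← Finset.sum_coe_sort (gdIndex n m)]
    exact Finset.sum_congr rfl fun j _ => by rw [hc']
  · rw [← hc' j]
    exact congrFun h0 ⟨j, hsub j.2⟩

end

theorem mainTheorem8 {C : Type*} [Field C] [CharZero C] (H : Hyperelliptic C)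
    {Θ : Type*} [Finite Θ] (n : ℕ) (hn : 2 ≤ n) (f : Fin (n - 1) → H.ParamExt Θ) :
    (∀ m : ℕ, levelVariety H f m =
      admissible H f ∩ MvPolynomial.zeroLocus C (levelIdeal H f m)) ∧
    (∀ m : ℕ, 1 ≤ m → levelVariety H f (m - 1) ⊆ levelVariety H f m) :=
  ⟨fun m => levelVariety_eq H m, fun m _ _ h =>
    ⟨h.1, gdV_ne_bot_mono _ _ (Nat.sub_le m 1) h.2⟩⟩
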